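/- Let $q\in\mathbb C^\times$ be not a root of unity. For $N\ge 1$ let $V=\mathbb C^N$ be the fundamental representation of $U_q(\mathfrak{gl}_N)$ with basis $e_1,\dots,e_N$, and let $\mathfrak R$ be its $R$-matrix on $V\otimes V$: $\mathfrak R(e_i\otimes e_i)=q\,e_i\otimes e_i$ and, for $i<j$, $\mathfrak R(e_i\otimes e_j)=e_j\otimes e_i+(q-q^{-1})\,e_i\otimes e_j$, $\mathfrak R(e_j\otimes e_i)=e_i\otimes e_j$. The generator $\sigma_\mu$ of the braid group on $m$ strands acts on $V^{\otimes m}$ by $\mathfrak R$ in the factors $\mu,\mu+1$. Put $q^\rho=\mathrm{diag}(q^{N-1},q^{N-3},\dots,q^{1-N})$ on $V$. The (unnormalized, without framing factor) fundamental HOMFLY polynomial $H_{[1]}^{\beta}(A)$ of a braid $\beta$ is the Laurent polynomial in $A$ with $$H_{[1]}^{\beta}(q^N)=\mathrm{Tr}_{V^{\otimes m}}\bigl((q^\rho)^{\otimes m}\,\beta\bigr)\qquad\text{for all integers } N\ge 1 .$$ Let $S_Q^*$ be the Schur function $S_Q$ expressed through the power sums $p_k$ and taken at $p_k=p_k^*=\dfrac{A^k-A^{-k}}{q^k-q^{-k}}$.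 Let $\mathcal M_Q$ be the multiplicity space of the irreducible representation $Q$ in $V^{\otimes 3}$, i.e. the space of highest weight vectors of weight $Q$ (the quantum group acting through $\Delta(E_i)=1\otimes E_i+E_i\otimes q^{-2H_i}$, where $2H_i$ acts on $V$ as $e_i\mapsto e_i$, $e_{i+1}\mapsto -e_{i+1}$, and $e_c\mapsto 0$ for all other $c$). Then for every integer $n$ the fundamental HOMFLY polynomial of the three-strand torus braid $(\sigma_1\sigma_2)^n$ exists, is unique, and equals $$H_{[1]}^{[3,n]}=q^{2n}S_{[3]}^*+2\cos\frac{2\pi n}{3}\;S_{[21]}^*+q^{-2n}S_{[111]}^* .$$ Moreover $\sigma_1\sigma_2$ preserves the spaces $\mathcal M_Q$, and its eigenvalues there, with multiplicity, are: $q^2$ on $\mathcal M_{[3]}$ (for $N\ge1$); $e^{2\pi i/3}$ and $e^{-2\pi i/3}$ on $\mathcal M_{[21]}$ (for $N\ge 2$); $q^{-2}$ on $\mathcal M_{[111]}$ (for $N\ge 3$). -/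

import Mathlib

noncomputable section

namespace BraidHomfly

/-! ### Braid groups -/

/-- The defining relators of the Artin braid group with generators `σ₀, …, σ_{k-1}`. -/
inductive BraidRelator (k : ℕ) : FreeGroup (Fin k) → Prop
  | far (i j : Fin k) (h : (i : ℕ) + 1 < j) :
      BraidRelator k (FreeGroup.of i * FreeGroup.of j * (FreeGroup.of j * FreeGroup.of i)⁻¹)
  | adjacent (i j : Fin k) (h : (i : ℕ) + 1 = j) :
      BraidRelator k (FreeGroup.of i * FreeGroup.of j * FreeGroup.of i *
        (FreeGroup.of j * FreeGroup.of i * FreeGroup.of j)⁻¹)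

/-- The Artin braid group on `k + 1` strands; its `k` generators are numbered from `0`. -/
abbrev BraidGroup (k : ℕ) : Type := PresentedGroup {r | BraidRelator k r}

/-- The generator `σ_i`, crossing the strands `i` and `i + 1`. -/
def sigma {k : ℕ} (i : Fin k) : BraidGroup k := PresentedGroup.of i

/-- The torus braid `(σ₁ σ₂)ⁿ` on three strands. -/
def torusBraid (n : ℤ) : BraidGroup 2 := (sigma 0 * sigma 1) ^ n

/-! ### The quantum `R`-matrix of the fundamental representation -/

/-- `V^{⊗ m}` for the fundamental representation `V = ℂ^N`: the function `v` stands for the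
tensor `∑ₓ v x • e_{x 0} ⊗ ⋯ ⊗ e_{x (m-1)}`. -/
abbrev TensorSpace (N m : ℕ) : Type := (Fin m → Fin N) → ℂ

/-- The fundamental `R`-matrix acting in the tensor factors `a` and `b`. On basis vectors it is
`e_i ⊗ e_i ↦ q e_i ⊗ e_i`, and for `i < j`
`e_i ⊗ e_j ↦ e_j ⊗ e_i + (q - q⁻¹) e_i ⊗ e_j`, `e_j ⊗ e_i ↦ e_i ⊗ e_j`. -/
def rMap (q : ℂˣ) (N : ℕ) {m : ℕ} (a b : Fin m) : Module.End ℂ (TensorSpace N m) where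
  toFun v x :=
    if x a = x b then (q : ℂ) * v x
    else if x a < x b then v (x ∘ Equiv.swap a b) + ((q : ℂ) - (q : ℂ)⁻¹) * v x
    else v (x ∘ Equiv.swap a b)
  map_add' v w := by
    funext x
    simp only [Pi.add_apply]
    split_ifs <;> ring
  map_smul' c v := by
    funext x
    simp only [Pi.smul_apply, smul_eq_mul, RingHom.id_apply]
    split_ifs <;> ring

/-- The inverse of the `R`-matrix acting in the tensor factors `a` and `b`. -/
def rMapInv (q : ℂˣ) (N : ℕ) {m : ℕ} (a b : Fin m) : Module.End ℂ (TensorSpace N m) where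
  toFun v x :=
    if x a = x b then (q : ℂ)⁻¹ * v x
    else if x a < x b then v (x ∘ Equiv.swap a b)
    else v (x ∘ Equiv.swap a b) - ((q : ℂ) - (q : ℂ)⁻¹) * v x
  map_add' v w := by
    funext x
    simp only [Pi.add_apply]
    split_ifs <;> ring
  map_smul' c v := by
    funext x
    simp only [Pi.smul_apply, smul_eq_mul, RingHom.id_apply]
    split_ifs <;> ring

theorem comp_swap_swap {N m : ℕ} (x : Fin m → Fin N) (a b : Fin m) :
    (x ∘ Equiv.swap a b) ∘ Equiv.swap a b = x := by
  funext c
  simp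

theorem rMap_mul_rMapInv (q : ℂˣ) (N : ℕ) {m : ℕ} (a b : Fin m) :
    rMap q N a b * rMapInv q N a b = 1 := by
  ext v x
  have hq : (q : ℂ) ≠ 0 := q.ne_zero
  rcases lt_trichotomy (x a) (x b) with h | h | h
  · simp [rMap, rMapInv, comp_swap_swap, h, h.ne, h.ne', h.not_gt]
  · simp [rMap, rMapInv, h]
  · simp [rMap, rMapInv, comp_swap_swap, h, h.ne, h.ne', h.not_gt]

theorem rMapInv_mul_rMap (q : ℂˣ) (N : ℕ) {m : ℕ} (a b : Fin m) :
    rMapInv q N a b * rMap q N a b = 1 := by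
  ext v x
  have hq : (q : ℂ) ≠ 0 := q.ne_zero
  rcases lt_trichotomy (x a) (x b) with h | h | h
  · simp [rMap, rMapInv, comp_swap_swap, h, h.ne, h.ne', h.not_gt]
  · simp [rMap, rMapInv, h]
  · simp [rMap, rMapInv, comp_swap_swap, h, h.ne, h.ne', h.not_gt]

/-- The `R`-matrix as an invertible operator. -/
def rUnit (q : ℂˣ) (N : ℕ) {m : ℕ} (a b : Fin m) : (Module.End ℂ (TensorSpace N m))ˣ where
  val := rMap q N a b
  inv := rMapInv q N a b
  val_inv := rMap_mul_rMapInv q N a b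
  inv_val := rMapInv_mul_rMap q N a b

theorem rMap_comm (q : ℂˣ) (N : ℕ) {m : ℕ} {a b c d : Fin m}
    (hac : a ≠ c) (had : a ≠ d) (hbc : b ≠ c) (hbd : b ≠ d) :
    rMap q N a b * rMap q N c d = rMap q N c d * rMap q N a b := by
  refine LinearMap.ext fun v => funext fun x => ?_
  have key : (x ∘ Equiv.swap a b) ∘ Equiv.swap c d = (x ∘ Equiv.swap c d) ∘ Equiv.swap a b := by
    funext e
    simp only [Function.comp_apply, Equiv.swap_apply_def]
    grind
  simp only [Module.End.mul_apply, rMap, LinearMap.coe_mk, AddHom.coe_mk, Function.comp_apply,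
    Equiv.swap_apply_of_ne_of_ne hac had, Equiv.swap_apply_of_ne_of_ne hbc hbd,
    Equiv.swap_apply_of_ne_of_ne hac.symm hbc.symm,
    Equiv.swap_apply_of_ne_of_ne had.symm hbd.symm, key]
  split_ifs <;> ring

theorem rMap_braid (q : ℂˣ) (N : ℕ) {m : ℕ} {a b c : Fin m}
    (hab : a ≠ b) (hac : a ≠ c) (hbc : b ≠ c) :
    rMap q N a b * rMap q N b c * rMap q N a b =
      rMap q N b c * rMap q N a b * rMap q N b c := by
  refine LinearMap.ext fun v => funext fun x => ?_
  have hq : (q : ℂ) ≠ 0 := q.ne_zero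
  have h1 : ∀ (d e : Fin m) (y : Fin m → Fin N), y d = y e → y ∘ Equiv.swap d e = y := by
    intro d e y h
    funext f
    simp only [Function.comp_apply, Equiv.swap_apply_def]
    grind
  have key : ((x ∘ Equiv.swap a b) ∘ Equiv.swap b c) ∘ Equiv.swap a b =
      ((x ∘ Equiv.swap b c) ∘ Equiv.swap a b) ∘ Equiv.swap b c := by
    funext e
    simp only [Function.comp_apply, Equiv.swap_apply_def]
    grind
  have ea := Equiv.swap_apply_of_ne_of_ne hab hac
  have ec := Equiv.swap_apply_of_ne_of_ne hac.symm hbc.symm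
  have h2 := h1 a b x
  have h3 := h1 b c x
  have h4 := h1 b c (x ∘ Equiv.swap a b)
  have h5 := h1 a b (x ∘ Equiv.swap b c)
  have h6 := comp_swap_swap x a b
  have h7 := comp_swap_swap x b c
  simp only [Function.comp_apply, Equiv.swap_apply_left, Equiv.swap_apply_right, ea, ec]
    at h4 h5
  simp only [Module.End.mul_apply, rMap, LinearMap.coe_mk, AddHom.coe_mk, Function.comp_apply,
    Equiv.swap_apply_left, Equiv.swap_apply_right, ea, ec]
  rw [h6, h7, key]
  revert h2 h3 h4 h5
  generalize ((x ∘ Equiv.swap b c) ∘ Equiv.swap a b) ∘ Equiv.swap b c = y0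
  generalize (x ∘ Equiv.swap b c) ∘ Equiv.swap a b = y1
  generalize (x ∘ Equiv.swap a b) ∘ Equiv.swap b c = y2
  generalize x ∘ Equiv.swap b c = y3
  generalize x ∘ Equiv.swap a b = y4
  generalize x a = i
  generalize x b = j
  generalize x c = k
  intro h2 h3 h4 h5
  have hz : (q : ℂ) * (q : ℂ)⁻¹ = 1 := mul_inv_cancel₀ hq
  generalize (q : ℂ)⁻¹ = z at hz ⊢
  rcases lt_trichotomy i j with hij | hij | hij <;>
  rcases lt_trichotomy j k with hjk | hjk | hjk <;>
  rcases lt_trichotomy i k with hik | hik | hik <;>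
  first
  | (exfalso; order)
  | (simp only [hij, hjk, hik, hij.ne, hij.ne', hij.not_gt, hjk.ne, hjk.ne', hjk.not_gt,
      hik.ne, hik.ne', hik.not_gt, if_true, if_false]; ring)
  | (clear key h6 h7 h1 ea ec; grind)

/-- The action of the braid group on `V^{⊗ (k + 1)}`: `σ_i` acts as the `R`-matrix in the tensor
factors `i` and `i + 1`. -/
def braidRep (q : ℂˣ) (N k : ℕ) :
    BraidGroup k →* (Module.End ℂ (TensorSpace N (k + 1)))ˣ :=
  PresentedGroup.toGroup (f := fun i : Fin k => rUnit q N i.castSucc i.succ) <| by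
    rintro r (⟨i, j, h⟩ | ⟨i, j, h⟩)
    · rw [map_mul, map_inv, mul_inv_eq_one]
      simp only [map_mul, FreeGroup.lift_apply_of]
      refine Units.ext (rMap_comm q N ?_ ?_ ?_ ?_) <;>
        · rw [Ne, Fin.ext_iff]
          simp only [Fin.val_castSucc, Fin.val_succ]
          omega
    · rw [map_mul, map_inv, mul_inv_eq_one]
      simp only [map_mul, FreeGroup.lift_apply_of]
      have hj : j.castSucc = i.succ := by
        rw [Fin.ext_iff]
        simp only [Fin.val_castSucc, Fin.val_succ]
        omega
      rw [hj]
      refine Units.ext (rMap_braid q N ?_ ?_ ?_) <;>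
        · rw [Ne, Fin.ext_iff]
          simp only [Fin.val_castSucc, Fin.val_succ]
          omega

/-! ### The weighted trace and the HOMFLY polynomial -/

/-- The weight operator `(q^ρ)^{⊗ m}`, where `q^ρ = diag(q^{N-1}, q^{N-3}, …, q^{1-N})` on `V`. -/
def weightOp (q : ℂˣ) (N m : ℕ) : Module.End ℂ (TensorSpace N m) :=
  LinearMap.pi fun x =>
    (∏ a, ((q ^ ((N : ℤ) - 1 - 2 * ((x a : ℕ) : ℤ)) : ℂˣ) : ℂ)) • LinearMap.proj x

/-- The weighted trace over `V^{⊗ (k + 1)}` of the product of `R`-matrices along a braid. -/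
def weightedTrace (q : ℂˣ) (N : ℕ) {k : ℕ} (β : BraidGroup k) : ℂ :=
  LinearMap.trace ℂ (TensorSpace N (k + 1))
    (weightOp q N (k + 1) * (braidRep q N k β : Module.End ℂ (TensorSpace N (k + 1))))

/-- `H` is the (unnormalized) fundamental HOMFLY polynomial of the closure of the braid `β`: a
Laurent polynomial in the variable `A` whose value at `A = q^N` is the weighted trace over
`(ℂ^N)^{⊗ (k + 1)}` of the product of `R`-matrices along `β`, for every `N ≥ 1`. -/
def IsHomfly (q : ℂˣ) {k : ℕ} (β : BraidGroup k) (H : LaurentPolynomial ℂ) : Prop :=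
  ∀ N : ℕ, 1 ≤ N → LaurentPolynomial.eval₂ (RingHom.id ℂ) (q ^ N) H = weightedTrace q N β

/-! ### Schur functions at the special point -/

/-- The complete homogeneous symmetric functions as polynomials in the power sums `p`:
`n h_n = ∑_{i=1}^n p_i h_{n-i}`. -/
def completeHom {R : Type*} [CommRing R] [Algebra ℂ R] (p : ℕ → R) : ℕ → R
  | 0 => 1
  | n + 1 => ((n : ℂ) + 1)⁻¹ • ∑ i : Fin (n + 1), p (i + 1) * completeHom p (n - i)

/-- The Schur function of the partition `Q = [q₁ ≥ q₂ ≥ …]` as a polynomial in the power sums `p`: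
the Jacobi–Trudi determinant `det (h_{q_i - i + j})`. -/
def schur {R : Type*} [CommRing R] [Algebra ℂ R] (p : ℕ → R) (Q : List ℕ) : R :=
  Matrix.det (Matrix.of fun i j : Fin Q.length =>
    if (i : ℕ) ≤ Q.get i + j then completeHom p (Q.get i + j - i) else 0)

/-- The special values `p_k^* = (A^k - A^{-k}) / (q^k - q^{-k})` of the power sums, as Laurent
polynomials in `A`. -/
def powerSumStar (q : ℂˣ) (k : ℕ) : LaurentPolynomial ℂ :=
  LaurentPolynomial.C (((q : ℂ) ^ k - ((q : ℂ) ^ k)⁻¹)⁻¹) *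
    (LaurentPolynomial.T (k : ℤ) - LaurentPolynomial.T (-(k : ℤ)))

/-- `S_Q^*`, the Schur function at `p_k = p_k^*`. -/
def schurStar (q : ℂˣ) (Q : List ℕ) : LaurentPolynomial ℂ := schur (powerSumStar q) Q

/-! ### The spaces of intertwining operators -/

/-- The eigenvalue exponent of `2 H_i` on the basis vector `e_c` of `V`. -/
def cartanWeight (i c : ℕ) : ℤ := if c = i then 1 else if c = i + 1 then -1 else 0

/-- The raising generator `E_i` (with `E_i e_{i+1} = e_i`) on `V^{⊗ m}`, through the
comultiplication `Δ(E) = 1 ⊗ E + E ⊗ q^{-2H}`: the sum over the factors `a` of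
`1 ⊗ ⋯ ⊗ 1 ⊗ E_i ⊗ q^{-2H_i} ⊗ ⋯ ⊗ q^{-2H_i}` with `E_i` in place `a`. -/
def raising (q : ℂˣ) (N m : ℕ) (i j : Fin N) : Module.End ℂ (TensorSpace N m) :=
  LinearMap.pi fun x => ∑ a : Fin m,
    if x a = i then
      (∏ b ∈ Finset.Ioi a, ((q ^ (-cartanWeight i (x b)) : ℂˣ) : ℂ)) •
        LinearMap.proj (R := ℂ) (φ := fun _ : Fin m → Fin N => ℂ) (Function.update x a j)
    else 0

/-- The multiplicity space `M_Q` of the irreducible representation `Q` of `U_q(gl_N)` in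
`V^{⊗ m}`, realized as the space of highest weight vectors of weight `Q`. -/
def multiplicitySpace (q : ℂˣ) (N m : ℕ) (Q : List ℕ) : Submodule ℂ (TensorSpace N m) where
  carrier := {v |
    (∀ x, v x ≠ 0 → ∀ c : Fin N, (Finset.univ.filter fun a => x a = c).card = Q.getD c 0) ∧
    ∀ i j : Fin N, (i : ℕ) + 1 = j → raising q N m i j v = 0}
  zero_mem' := by simp
  add_mem' := by
    rintro v w ⟨hv, hv'⟩ ⟨hw, hw'⟩
    refine ⟨fun x hx c => ?_, fun i j h => ?_⟩
    · by_cases h0 : v x = 0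
      · exact hw x (fun h1 => hx (by simp [h0, h1])) c
      · exact hv x h0 c
    · rw [map_add, hv' i j h, hw' i j h, add_zero]
  smul_mem' := by
    rintro t v ⟨hv, hv'⟩
    refine ⟨fun x hx c => hv x (fun h0 => hx (by simp [h0])) c, fun i j h => ?_⟩
    rw [map_smul, hv' i j h, smul_zero]

/-- A braid maps the multiplicity space `M_Q` to itself, and `f` is the characteristic polynomial
of its action there. -/
def HasCharpolyOn (q : ℂˣ) (N : ℕ) {k : ℕ} (β : BraidGroup k) (Q : List ℕ)
    (f : Polynomial ℂ) : Prop :=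
  ∃ h : ∀ v ∈ multiplicitySpace q N (k + 1) Q,
      (braidRep q N k β : Module.End ℂ (TensorSpace N (k + 1))) v ∈
        multiplicitySpace q N (k + 1) Q,
    (LinearMap.restrict (braidRep q N k β : Module.End ℂ (TensorSpace N (k + 1))) h).charpoly = f

end BraidHomfly

end

noncomputable section

namespace BraidHomfly

/-! ### Operators on basis vectors -/

/-! Write T = R₁R₂ for the operator of σ₁σ₂ on V^{⊗3} and z = q - q⁻¹. The quadratic Hecke relation
R² = 1 + zR and the braid relation force (T² - (z² + 2)T + 1)(T² + T + 1) = 0, whose roots are q²,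
q⁻² and the two primitive cube roots of unity (`hecke_mul_pow_relation`). Hence the weighted trace
of Tⁿ satisfies a linear recurrence of order four in n ∈ ℤ (`weightedTrace_torusBraid_recurrence`).
The proposed right-hand side satisfies the same recurrence (`character_recurrence`), so it suffices
to compare n = -1, 0, 1, 2. No decomposition of V^{⊗3} into irreducibles is needed.

The four traces follow from a Markov property: the partial trace of q^ρ R over its first factor is
the scalar q^N (`sum_rhoDiag_mul_rDiag`). Each trace is then a polynomial in q, q⁻¹, q^N and the
quantum dimension p₁^*. Equality with the Schur side is an identity of rational functions
(`torusBraid_character_identities`). Uniqueness of H holds because the points q^N are pairwise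
distinct, so a Laurent polynomial vanishing at all of them is zero.

The spectra come from explicit bases of highest weight vectors, of sizes 1, 2 and 1, on which the
matrix of T is written out. -/

/-- The basis vector `e_x` of `V^{⊗ m}`. -/
abbrev basisVec {N m : ℕ} (x : Fin m → Fin N) : TensorSpace N m := Pi.single x 1

theorem comp_swap_eq_iff {N m : ℕ} (x y : Fin m → Fin N) (a b : Fin m) :
    x ∘ Equiv.swap a b = y ↔ x = y ∘ Equiv.swap a b := by
  constructor
  · rintro rfl; rw [comp_swap_swap]
  · rintro rfl; rw [comp_swap_swap]

theorem comp_swap_of_eq {N m : ℕ} {x : Fin m → Fin N} {a b : Fin m} (h : x a = x b) :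
    x ∘ Equiv.swap a b = x := by
  funext c
  simp only [Function.comp_apply, Equiv.swap_apply_def]
  grind

/-- `rMap` is defined on coordinates. Its matrix is symmetric, so basis vectors obey a formula of
the same shape. -/
theorem rMap_basisVec (q : ℂˣ) (N : ℕ) {m : ℕ} (a b : Fin m) (x : Fin m → Fin N) :
    rMap q N a b (basisVec x) =
      if x a = x b then (q : ℂ) • basisVec x
      else if x a < x b then basisVec (x ∘ Equiv.swap a b) + ((q : ℂ) - (q : ℂ)⁻¹) • basisVec x
      else basisVec (x ∘ Equiv.swap a b) := by
  funext y
  have hs : ∀ z : Fin m → Fin N, (z ∘ Equiv.swap a b) a = z b ∧ (z ∘ Equiv.swap a b) b = z a := by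
    intro z; simp
  by_cases hy : y = x
  · subst hy
    by_cases h : y a = y b
    · simp [rMap, h]
    · have : y ∘ Equiv.swap a b ≠ y := fun h' => h (by rw [← (hs y).2, h'])
      by_cases h2 : y a < y b <;> simp [rMap, h, h2, this, this.symm]
  · by_cases hy2 : y ∘ Equiv.swap a b = x
    · subst hy2
      obtain ⟨h1, h2⟩ := hs y
      rcases lt_trichotomy (y a) (y b) with h | h | h
      · simp [rMap, h, h.ne, h.ne', h.not_gt, comp_swap_swap, hy]
      · exact absurd (comp_swap_of_eq h).symm hy
      · simp [rMap, h, h.ne, h.ne', h.not_gt, comp_swap_swap, hy]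
    · have hy3 : y ≠ x ∘ Equiv.swap a b := fun h => hy2 ((comp_swap_eq_iff _ _ _ _).2 h)
      simp only [rMap, LinearMap.coe_mk, AddHom.coe_mk]
      split_ifs <;> simp [hy, hy2, hy3]

/-- This is the transpose of the coordinate definition: changing the letter i to j in place a is
undone by changing j to i there. The power of q agrees because it involves only places after a. The
coordinate form yields the equations cutting out highest weight vectors; this form checks that given
vectors are annihilated. -/
theorem raising_basisVec (q : ℂˣ) (N : ℕ) {m : ℕ} (i j : Fin N) (x : Fin m → Fin N) :
    raising q N m i j (basisVec x) =
      ∑ a : Fin m, if x a = j then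
        (∏ b ∈ Finset.Ioi a, ((q ^ (-cartanWeight i (x b)) : ℂˣ) : ℂ)) •
          basisVec (Function.update x a i) else 0 := by
  funext y
  simp only [raising, LinearMap.pi_apply, LinearMap.sum_apply, Finset.sum_apply]
  refine Finset.sum_congr rfl fun a _ => ?_
  by_cases h : y a = i ∧ Function.update y a j = x
  · obtain ⟨rfl, rfl⟩ := h
    simp only [if_true, Function.update_self, Function.update_idem, Function.update_eq_self,
      LinearMap.smul_apply, LinearMap.proj_apply, Pi.smul_apply, Pi.single_eq_same]
    congr 1
    refine Finset.prod_congr rfl fun b hb => ?_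
    rw [Function.update_of_ne (Finset.mem_Ioi.1 hb).ne']
  · have h' : ¬ (x a = j ∧ Function.update x a i = y) := by
      rintro ⟨rfl, rfl⟩
      exact h (by simp)
    trans (0 : ℂ)
    · split_ifs with h1
      · have : Function.update y a j ≠ x := fun h2 => h ⟨h1, h2⟩
        simp [this]
      · rfl
    · split_ifs with h1
      · have : y ≠ Function.update x a i := fun h2 => h' ⟨h1, h2.symm⟩
        simp [this]
      · rfl

/-- The basis vector `e_i ⊗ e_j ⊗ e_k`. -/
abbrev basisVec₃ {N : ℕ} (i j k : Fin N) : TensorSpace N 3 := basisVec ![i, j, k]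

section
variable (q : ℂˣ) {N : ℕ} (i j k : Fin N)

theorem comp_swap_zero_one : ![i, j, k] ∘ Equiv.swap 0 1 = ![j, i, k] := by
  funext c; fin_cases c <;> rfl

theorem comp_swap_one_two : ![i, j, k] ∘ Equiv.swap 1 2 = ![i, k, j] := by
  funext c; fin_cases c <;> rfl

theorem rMap_zero_one_basisVec₃ :
    rMap q N 0 1 (basisVec₃ i j k) =
      if i = j then (q : ℂ) • basisVec₃ i j k
      else if i < j then basisVec₃ j i k + ((q : ℂ) - (q : ℂ)⁻¹) • basisVec₃ i j k
      else basisVec₃ j i k := by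
  rw [rMap_basisVec, comp_swap_zero_one]; rfl

theorem rMap_one_two_basisVec₃ :
    rMap q N 1 2 (basisVec₃ i j k) =
      if j = k then (q : ℂ) • basisVec₃ i j k
      else if j < k then basisVec₃ i k j + ((q : ℂ) - (q : ℂ)⁻¹) • basisVec₃ i j k
      else basisVec₃ i k j := by
  rw [rMap_basisVec, comp_swap_one_two]; rfl

theorem raising_apply₃ (v : TensorSpace N 3) (c d : Fin N) :
    raising q N 3 c d v ![i, j, k] =
      (if i = c then ((q ^ (-cartanWeight c j) : ℂˣ) : ℂ) * ((q ^ (-cartanWeight c k) : ℂˣ) : ℂ) *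
        v ![d, j, k] else 0) +
      (if j = c then ((q ^ (-cartanWeight c k) : ℂˣ) : ℂ) * v ![i, d, k] else 0) +
      (if k = c then v ![i, j, d] else 0) := by
  have h0 : Finset.Ioi (0 : Fin 3) = {1, 2} := by decide
  have h1 : Finset.Ioi (1 : Fin 3) = {2} := by decide
  have h2 : Finset.Ioi (2 : Fin 3) = ∅ := by decide
  have u0 : Function.update ![i, j, k] 0 d = ![d, j, k] := by
    funext c; fin_cases c <;> rfl
  have u1 : Function.update ![i, j, k] 1 d = ![i, d, k] := by
    funext c; fin_cases c <;> rfl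
  have u2 : Function.update ![i, j, k] 2 d = ![i, j, d] := by
    funext c; fin_cases c <;> rfl
  simp only [raising, LinearMap.pi_apply, Fin.sum_univ_three, LinearMap.add_apply, h0, h1, h2,
    u0, u1, u2, Finset.prod_empty, Finset.prod_singleton,
    Finset.prod_pair (show (1 : Fin 3) ≠ 2 by decide)]
  refine congrArg₂ _ (congrArg₂ _ ?_ ?_) ?_
  · change (if i = c then _ else _ : _ →ₗ[ℂ] ℂ) v = _
    split_ifs <;> simp
  · change (if j = c then _ else _ : _ →ₗ[ℂ] ℂ) v = _
    split_ifs <;> simp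
  · change (if k = c then _ else _ : _ →ₗ[ℂ] ℂ) v = _
    split_ifs <;> simp

theorem raising_basisVec₃ (c d : Fin N) :
    raising q N 3 c d (basisVec₃ i j k) =
      (if i = d then (((q ^ (-cartanWeight c j) : ℂˣ) : ℂ) *
        ((q ^ (-cartanWeight c k) : ℂˣ) : ℂ)) • basisVec₃ c j k else 0) +
      (if j = d then ((q ^ (-cartanWeight c k) : ℂˣ) : ℂ) • basisVec₃ i c k else 0) +
      (if k = d then basisVec₃ i j c else 0) := by
  have h0 : Finset.Ioi (0 : Fin 3) = {1, 2} := by decide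
  have h1 : Finset.Ioi (1 : Fin 3) = {2} := by decide
  have h2 : Finset.Ioi (2 : Fin 3) = ∅ := by decide
  have u0 : Function.update ![i, j, k] 0 c = ![c, j, k] := by
    funext c; fin_cases c <;> rfl
  have u1 : Function.update ![i, j, k] 1 c = ![i, c, k] := by
    funext c; fin_cases c <;> rfl
  have u2 : Function.update ![i, j, k] 2 c = ![i, j, c] := by
    funext c; fin_cases c <;> rfl
  rw [raising_basisVec]
  simp only [Fin.sum_univ_three, h0, h1, h2, u0, u1, u2, Finset.prod_empty, Finset.prod_singleton,
    Finset.prod_pair (show (1 : Fin 3) ≠ 2 by decide), one_smul]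
  rfl

end

/-! ### Spectra on the multiplicity spaces -/

/-- The characteristic polynomial on an invariant subspace, from a parametrization. -/
theorem exists_restrict_charpoly {V : Type*} [AddCommGroup V] [Module ℂ V]
    [FiniteDimensional ℂ V] {d : ℕ}
    (T : Module.End ℂ V) (M : Submodule ℂ V) (A : Matrix (Fin d) (Fin d) ℂ)
    (u : Fin d → V) (hu : LinearIndependent ℂ u) (hM : M = Submodule.span ℂ (Set.range u))
    (hT : ∀ j, T (u j) = ∑ i, A i j • u i) :
    ∃ h : ∀ v ∈ M, T v ∈ M, (T.restrict h).charpoly = A.charpoly := by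
  subst hM
  have h : ∀ v ∈ Submodule.span ℂ (Set.range u), T v ∈ Submodule.span ℂ (Set.range u) := by
    intro v hv
    induction hv using Submodule.span_induction with
    | mem x hx =>
      obtain ⟨j, rfl⟩ := hx
      rw [hT]
      exact Submodule.sum_mem _ fun i _ =>
        Submodule.smul_mem _ _ (Submodule.subset_span ⟨i, rfl⟩)
    | zero => simp
    | add x y _ _ hx hy => rw [map_add]; exact Submodule.add_mem _ hx hy
    | smul c x _ hx => rw [map_smul]; exact Submodule.smul_mem _ _ hx
  refine ⟨h, ?_⟩
  let b := Module.Basis.span hu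
  have hb : ∀ j, (b j : V) = u j := fun j => by simp [b, Module.Basis.span_apply]
  rw [← LinearMap.charpoly_toMatrix _ b]
  congr 1
  have : T.restrict h = Matrix.toLin b b A := by
    refine b.ext fun j => Subtype.ext ?_
    rw [Matrix.toLin_self]
    simp [hb, hT]
  rw [this, LinearMap.toMatrix_toLin]

theorem braidRep_sigma_mul (q : ℂˣ) (N : ℕ) :
    (braidRep q N 2 (sigma 0 * sigma 1) : Module.End ℂ (TensorSpace N 3)) =
      rMap q N 0 1 * rMap q N 1 2 := by
  rw [map_mul]
  simp only [braidRep, sigma, PresentedGroup.toGroup.of, Units.val_mul]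
  rfl

theorem exists_eq_cons₃ {N : ℕ} (x : Fin 3 → Fin N) : ∃ i j k, x = ![i, j, k] :=
  ⟨x 0, x 1, x 2, by funext c; fin_cases c <;> rfl⟩

theorem card_filter_cons₃ {N : ℕ} (i j k c : Fin N) :
    (Finset.univ.filter fun a => ![i, j, k] a = c).card =
      (if i = c then 1 else 0) + (if j = c then 1 else 0) + (if k = c then 1 else 0) := by
  rw [Finset.card_filter, Fin.sum_univ_three]
  rfl

theorem multiplicitySpace_one_row (q : ℂˣ) (N : ℕ) :
    multiplicitySpace q (N + 1) 3 [3] =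
      Submodule.span ℂ (Set.range ![(basisVec₃ 0 0 0 : TensorSpace (N + 1) 3)]) := by
  apply le_antisymm
  · rintro v ⟨hv, -⟩
    have : v = v ![0, 0, 0] • basisVec₃ 0 0 0 := by
      funext x
      by_cases hx : x = ![0, 0, 0]
      · simp [hx]
      · have : v x = 0 := by
          by_contra h
          obtain ⟨i, j, k, rfl⟩ := exists_eq_cons₃ x
          -- The weight condition alone suffices here: the letter 0 must occupy all three places.
          have := hv _ h 0
          rw [card_filter_cons₃] at this
          simp only [Fin.val_zero, List.getD_cons_zero] at this
          split_ifs at this <;> simp_all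
        simp [this, hx]
    rw [this]
    exact Submodule.smul_mem _ _ (Submodule.subset_span ⟨0, rfl⟩)
  · rw [Submodule.span_le]
    rintro _ ⟨t, rfl⟩
    refine ⟨fun x hx c => ?_, fun i j hij => ?_⟩
    · have : x = ![0, 0, 0] := by
        by_contra h
        simp [h] at hx
      rw [this, card_filter_cons₃]
      induction c using Fin.cases with
      | zero => simp
      | succ c => simp [(Fin.succ_ne_zero c).symm]
    · have hj : 0 ≠ j := fun h => by simp [← h] at hij
      simp [raising_basisVec₃, hj]

theorem hasCharpolyOn_one_row (q : ℂˣ) (N : ℕ) :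
    HasCharpolyOn q (N + 1) (sigma 0 * sigma 1 : BraidGroup 2) [3]
      (Polynomial.X - Polynomial.C ((q : ℂ) ^ 2)) := by
  obtain ⟨h, h'⟩ := exists_restrict_charpoly (rMap q (N + 1) 0 1 * rMap q (N + 1) 1 2) _
    !![(q : ℂ) ^ 2] _ (LinearIndependent.of_subsingleton 0 (by simp))
    (multiplicitySpace_one_row q N) (by
      intro j
      fin_cases j
      simp [rMap_zero_one_basisVec₃, rMap_one_two_basisVec₃, smul_smul, sq])
  rw [← braidRep_sigma_mul] at h
  refine ⟨h, ?_⟩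
  simp only [braidRep_sigma_mul]
  rw [h']
  simp [Matrix.charpoly, Matrix.charmatrix]

/-- The highest weight vectors of weight `[2, 1]`. -/
def hookVec (q : ℂˣ) (N : ℕ) : Fin 2 → TensorSpace (N + 2) 3 :=
  ![basisVec₃ 0 0 1 - (q : ℂ) ^ 2 • basisVec₃ 1 0 0, basisVec₃ 0 1 0 - (q : ℂ) • basisVec₃ 1 0 0]

theorem linearIndependent_hookVec (q : ℂˣ) (N : ℕ) : LinearIndependent ℂ (hookVec q N) := by
  rw [Fintype.linearIndependent_iff]
  intro g hg
  rw [Fin.sum_univ_two] at hg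
  have h0 := congrFun hg ![0, 0, 1]
  have h1 := congrFun hg ![0, 1, 0]
  simp [hookVec] at h0 h1
  intro i
  fin_cases i
  · exact h0
  · exact h1

/-- The weight space is spanned by the words 001, 010, 100. The only nontrivial condition is E₀v = 0
read at 000, which determines the coordinate at 100 and leaves the other two free. -/
theorem multiplicitySpace_hook (q : ℂˣ) (N : ℕ) :
    multiplicitySpace q (N + 2) 3 [2, 1] = Submodule.span ℂ (Set.range (hookVec q N)) := by
  have hq := q.ne_zero
  apply le_antisymm
  · rintro v ⟨hv, hE⟩
    have hE0 := congrFun (hE 0 1 (by simp)) ![0, 0, 0]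
    rw [raising_apply₃] at hE0
    simp [cartanWeight] at hE0
    have hv1 : v ![1, 0, 0] = -(q : ℂ) ^ 2 * v ![0, 0, 1] - q * v ![0, 1, 0] := by
      field_simp at hE0
      linear_combination hE0
    have : v = v ![0, 0, 1] • hookVec q N 0 + v ![0, 1, 0] • hookVec q N 1 := by
      funext x
      by_cases hx : x = ![0, 0, 1] ∨ x = ![0, 1, 0] ∨ x = ![1, 0, 0]
      · rcases hx with rfl | rfl | rfl
        · simp [hookVec]
        · simp [hookVec]
        · rw [hv1]
          simp [hookVec]
          ring
      · have : v x = 0 := by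
          by_contra h
          obtain ⟨i, j, k, rfl⟩ := exists_eq_cons₃ x
          have h0 := hv _ h 0
          have h1 := hv _ h 1
          rw [card_filter_cons₃] at h0 h1
          simp only [Fin.val_zero, Fin.val_one, List.getD_cons_zero, List.getD_cons_succ] at h0 h1
          clear hE0 hv1 hE hv h
          split_ifs at h0 h1 <;> simp_all
        push Not at hx
        simp [this, hx, hookVec]
    rw [this]
    exact Submodule.add_mem _ (Submodule.smul_mem _ _ (Submodule.subset_span ⟨0, rfl⟩))
      (Submodule.smul_mem _ _ (Submodule.subset_span ⟨1, rfl⟩))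
  · rw [Submodule.span_le]
    rintro _ ⟨t, rfl⟩
    refine ⟨fun x hx c => ?_, fun i j hij => ?_⟩
    · have : x = ![0, 0, 1] ∨ x = ![0, 1, 0] ∨ x = ![1, 0, 0] := by
        by_contra h
        push Not at h
        fin_cases t <;> simp [hookVec, h] at hx
      -- The default value 0 says that letters from 2 onwards do not occur.
      have hc : [2, 1].getD (c : ℕ) 0 = (if 0 = c then 2 else 0) + (if 1 = c then 1 else 0) := by
        induction c using Fin.cases with
        | zero => simp
        | succ c =>
          induction c using Fin.cases with
          | zero => simp
          | succ c => simp [Fin.ext_iff]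
      rw [hc]
      rcases this with rfl | rfl | rfl <;> rw [card_filter_cons₃] <;> split_ifs <;> simp_all
    · have hj : 0 ≠ j := fun h => by simp [← h] at hij
      by_cases hj1 : 1 = j
      · subst hj1
        obtain rfl : i = 0 := by
          rw [Fin.ext_iff]
          simpa using hij
        fin_cases t
        · simp [hookVec, raising_basisVec₃, cartanWeight, smul_smul]
          match_scalars
          field_simp
          simp
        · simp [hookVec, raising_basisVec₃, cartanWeight, smul_smul, hq]
      · fin_cases t <;> simp [hookVec, raising_basisVec₃, hj, hj1]

theorem hasCharpolyOn_hook (q : ℂˣ) (N : ℕ) :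
    HasCharpolyOn q (N + 2) (sigma 0 * sigma 1 : BraidGroup 2) [2, 1]
      (Polynomial.X ^ 2 + Polynomial.X + 1) := by
  have hq := q.ne_zero
  obtain ⟨h, h'⟩ := exists_restrict_charpoly (rMap q (N + 2) 0 1 * rMap q (N + 2) 1 2) _
    -- Column j holds the coordinates at 001 and 010 of the image of `hookVec q N j`, since these
    -- two words separate the basis. The trace is -1 and the determinant 1, whatever q is.
    !![(q : ℂ) ^ 2 - 1, q; (q : ℂ) - (q : ℂ)⁻¹ - q ^ 3, - q ^ 2] _ (linearIndependent_hookVec q N)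
    (multiplicitySpace_hook q N) (by
      have h01 : (q : ℂ) * (q - (q : ℂ)⁻¹) = q ^ 2 - 1 := by field_simp
      intro j
      fin_cases j <;>
      simp [hookVec, rMap_zero_one_basisVec₃, rMap_one_two_basisVec₃, Fin.sum_univ_two]
      · match_scalars <;> (field_simp; try ring)
      · match_scalars <;> (field_simp; try ring))
  rw [← braidRep_sigma_mul] at h
  refine ⟨h, ?_⟩
  simp only [braidRep_sigma_mul]
  rw [h', Matrix.charpoly_fin_two, Matrix.trace_fin_two_of, Matrix.det_fin_two_of,
    show (q : ℂ) ^ 2 - 1 + - q ^ 2 = -1 by ring,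
    show ((q : ℂ) ^ 2 - 1) * - q ^ 2 - q * ((q : ℂ) - (q : ℂ)⁻¹ - q ^ 3) = 1 by field_simp; ring]
  simp

/-- The highest weight vector of weight `[1, 1, 1]`. -/
def columnVec (q : ℂˣ) (N : ℕ) : TensorSpace (N + 3) 3 :=
  basisVec₃ 0 1 2 - (q : ℂ) • basisVec₃ 1 0 2 - (q : ℂ) • basisVec₃ 0 2 1 +
    (q : ℂ) ^ 2 • basisVec₃ 1 2 0 + (q : ℂ) ^ 2 • basisVec₃ 2 0 1 - (q : ℂ) ^ 3 • basisVec₃ 2 1 0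

theorem zero_lt_two_fin (N : ℕ) : (0 : Fin (N + 3)) < 2 := by
  rw [Fin.lt_def, Fin.val_two]
  simp

theorem one_lt_two_fin (N : ℕ) : (1 : Fin (N + 3)) < 2 := by
  rw [Fin.lt_def, Fin.val_two]
  simp

theorem eq_cons₃_of_column {N : ℕ} {i j k : Fin (N + 3)}
    (h : ∀ c : Fin (N + 3), (if i = c then 1 else 0) + (if j = c then 1 else 0) +
      (if k = c then 1 else 0) = [1, 1, 1].getD (c : ℕ) 0) :
    ![i, j, k] = ![0, 1, 2] ∨ ![i, j, k] = ![1, 0, 2] ∨ ![i, j, k] = ![0, 2, 1] ∨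
      ![i, j, k] = ![1, 2, 0] ∨ ![i, j, k] = ![2, 0, 1] ∨ ![i, j, k] = ![2, 1, 0] := by
  have n02 := (zero_lt_two_fin N).ne
  have n12 := (one_lt_two_fin N).ne
  have n01 : (0 : Fin (N + 3)) ≠ 1 := by simp
  have h0 := h 0
  have h1 := h 1
  have h2 := h 2
  simp only [Fin.val_zero, Fin.val_one, Fin.val_two, List.getD_cons_zero,
    List.getD_cons_succ] at h0 h1 h2
  have key : (i = 0 ∧ j = 1 ∧ k = 2) ∨ (i = 1 ∧ j = 0 ∧ k = 2) ∨ (i = 0 ∧ j = 2 ∧ k = 1) ∨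
      (i = 1 ∧ j = 2 ∧ k = 0) ∨ (i = 2 ∧ j = 0 ∧ k = 1) ∨ (i = 2 ∧ j = 1 ∧ k = 0) := by
    clear h
    grind
  rcases key with ⟨rfl, rfl, rfl⟩ | ⟨rfl, rfl, rfl⟩ | ⟨rfl, rfl, rfl⟩ | ⟨rfl, rfl, rfl⟩ |
    ⟨rfl, rfl, rfl⟩ | ⟨rfl, rfl, rfl⟩ <;> simp

/-- The weight space is spanned by the six permutations of 012. The highest weight equations relate
words differing by an adjacent transposition with a factor -q, so each coordinate is (-q) to the
number of inversions, times the one at 012. -/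
theorem multiplicitySpace_column (q : ℂˣ) (N : ℕ) :
    multiplicitySpace q (N + 3) 3 [1, 1, 1] =
      Submodule.span ℂ (Set.range ![columnVec q N]) := by
  have hq := q.ne_zero
  have n02 := (zero_lt_two_fin N).ne
  have n12 := (one_lt_two_fin N).ne
  have hm : 2 % (N + 3) = 2 := Nat.mod_eq_of_lt (by omega)
  apply le_antisymm
  · rintro v ⟨hv, hE⟩
    -- Five equations suffice to express five coordinates through the sixth; E₁ at 110 would give
    -- nothing new.
    have e1 := congrFun (hE 0 1 (by simp)) ![0, 0, 2]
    have e2 := congrFun (hE 0 1 (by simp)) ![0, 2, 0]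
    have e3 := congrFun (hE 0 1 (by simp)) ![2, 0, 0]
    have e4 := congrFun (hE 1 2 (by simp [hm])) ![0, 1, 1]
    have e5 := congrFun (hE 1 2 (by simp [hm])) ![1, 0, 1]
    rw [raising_apply₃] at e1 e2 e3 e4 e5
    simp [cartanWeight, hm, n02.symm] at e1 e2 e3 e4 e5
    field_simp at e1 e2 e3 e4 e5
    have v1 : v ![1, 0, 2] = -q * v ![0, 1, 2] := by linear_combination e1
    have v2 : v ![0, 2, 1] = -q * v ![0, 1, 2] := by linear_combination e4
    have v3 : v ![1, 2, 0] = q ^ 2 * v ![0, 1, 2] := by linear_combination e2 - q * e4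
    have v4 : v ![2, 0, 1] = q ^ 2 * v ![0, 1, 2] := by linear_combination e5 - q * e1
    have v5 : v ![2, 1, 0] = - q ^ 3 * v ![0, 1, 2] := by linear_combination e3 - q * v4
    clear e1 e2 e3 e4 e5 hE
    have : v = v ![0, 1, 2] • columnVec q N := by
      funext x
      by_cases hx : x = ![0, 1, 2] ∨ x = ![1, 0, 2] ∨ x = ![0, 2, 1] ∨ x = ![1, 2, 0] ∨
        x = ![2, 0, 1] ∨ x = ![2, 1, 0]
      · rcases hx with rfl | rfl | rfl | rfl | rfl | rfl <;>
        simp [columnVec, n02, n02.symm, n12, n12.symm, v1, v2, v3, v4, v5, mul_comm]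
      · have : v x = 0 := by
          by_contra h
          obtain ⟨i, j, k, rfl⟩ := exists_eq_cons₃ x
          exact hx (eq_cons₃_of_column fun c => by rw [← card_filter_cons₃, hv _ h c])
        push Not at hx
        simp [this, hx, columnVec]
    rw [this]
    exact Submodule.smul_mem _ _ (Submodule.subset_span ⟨0, rfl⟩)
  · rw [Submodule.span_le]
    rintro _ ⟨t, rfl⟩
    refine ⟨fun x hx c => ?_, fun i j hij => ?_⟩
    · have : x = ![0, 1, 2] ∨ x = ![1, 0, 2] ∨ x = ![0, 2, 1] ∨ x = ![1, 2, 0] ∨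
        x = ![2, 0, 1] ∨ x = ![2, 1, 0] := by
        by_contra h
        push Not at h
        simp [columnVec, h] at hx
      have hc : [1, 1, 1].getD (c : ℕ) 0 =
          (if 0 = c then 1 else 0) + (if 1 = c then 1 else 0) + (if 2 = c then 1 else 0) := by
        simp only [Fin.ext_iff, Fin.val_zero, Fin.val_one, Fin.val_two]
        rcases (c : ℕ) with _ | _ | _ | c <;> simp
      rw [hc]
      rcases this with rfl | rfl | rfl | rfl | rfl | rfl <;> rw [card_filter_cons₃] <;> ring
    · have hj : 0 ≠ j := fun h => by simp [← h] at hij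
      by_cases hj1 : 1 = j
      · subst hj1
        obtain rfl : i = 0 := by
          rw [Fin.ext_iff]
          simpa using hij
        simp [columnVec, raising_basisVec₃, cartanWeight, smul_smul, n12.symm, hm]
        match_scalars <;> (field_simp; try ring)
      by_cases hj2 : 2 = j
      · subst hj2
        obtain rfl : i = 1 := by
          rw [Fin.ext_iff]
          simpa [hm] using hij
        simp [columnVec, raising_basisVec₃, cartanWeight, smul_smul, n12, n02]
        match_scalars <;> (field_simp; try ring)
      · simp [columnVec, raising_basisVec₃, hj, hj1, hj2]

/-- On the q-antisymmetric vector each of the two R-matrices acts by -q⁻¹, which gives q⁻² for the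
product. -/
theorem hasCharpolyOn_column (q : ℂˣ) (N : ℕ) :
    HasCharpolyOn q (N + 3) (sigma 0 * sigma 1 : BraidGroup 2) [1, 1, 1]
      (Polynomial.X - Polynomial.C ((q : ℂ) ^ 2)⁻¹) := by
  have hq := q.ne_zero
  have l02 := zero_lt_two_fin N
  have l12 := one_lt_two_fin N
  obtain ⟨h, h'⟩ := exists_restrict_charpoly (rMap q (N + 3) 0 1 * rMap q (N + 3) 1 2) _
    !![((q : ℂ) ^ 2)⁻¹] _ (LinearIndependent.of_subsingleton 0 (by
      intro h
      have := congrFun h ![0, 1, 2]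
      simp [columnVec, l02.ne, l12.ne] at this))
    (multiplicitySpace_column q N) (by
      intro j
      fin_cases j
      simp [columnVec, rMap_zero_one_basisVec₃, rMap_one_two_basisVec₃, l02, l12, l02.ne, l12.ne,
        l02.ne', l12.ne', l02.not_gt, l12.not_gt]
      match_scalars <;> (field_simp; try ring))
  rw [← braidRep_sigma_mul] at h
  refine ⟨h, ?_⟩
  simp only [braidRep_sigma_mul]
  rw [h']
  simp [Matrix.charpoly, Matrix.charmatrix]

/-! ### The Hecke relations -/

/-- This is the Hecke relation in the form R - R⁻¹ = q - q⁻¹. -/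
theorem rMapInv_eq (q : ℂˣ) (N : ℕ) {m : ℕ} (a b : Fin m) :
    rMapInv q N a b = rMap q N a b - ((q : ℂ) - (q : ℂ)⁻¹) • 1 := by
  refine LinearMap.ext fun v => funext fun x => ?_
  simp only [rMap, rMapInv, LinearMap.coe_mk, AddHom.coe_mk, LinearMap.sub_apply,
    LinearMap.smul_apply, Module.End.one_apply, Pi.sub_apply, Pi.smul_apply, smul_eq_mul]
  split_ifs <;> ring

theorem rMap_mul_self (q : ℂˣ) (N : ℕ) {m : ℕ} (a b : Fin m) :
    rMap q N a b * rMap q N a b = 1 + ((q : ℂ) - (q : ℂ)⁻¹) • rMap q N a b := by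
  have h2 := rMap_mul_rMapInv q N a b
  rw [rMapInv_eq, mul_sub, mul_smul_comm, mul_one] at h2
  rw [← h2]; abel

section Hecke
variable {A : Type*} [Ring A] [Algebra ℂ A] {a b : A} {z : ℂ}

/-- The product of the generators of the Hecke algebra of type `A₂` is annihilated by
`(X² - (z² + 2) X + 1) (X² + X + 1)`. -/
theorem hecke_mul_pow_relation (ha : a * a = 1 + z • a) (hb : b * b = 1 + z • b)
    (hab : a * b * a = b * a * b) :
    (a * b) ^ 4 - (1 + z ^ 2) • (a * b) ^ 3 - z ^ 2 • (a * b) ^ 2 - (1 + z ^ 2) • (a * b) + 1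
      = 0 := by
  have ha' : ∀ x, a * (a * x) = x + z • (a * x) := fun x => by
    rw [← mul_assoc, ha, add_mul, one_mul, smul_mul_assoc]
  have h1 : b * (a * b) = a * (b * a) := by rw [← mul_assoc, ← mul_assoc, hab]
  -- The rules reduce every power to a combination of 1, a, b, ab, ba, aba, where the coefficients
  -- cancel.
  simp only [pow_succ, pow_zero, one_mul, mul_assoc, hb, ha', h1, mul_add, add_mul, mul_one,
    smul_mul_assoc, mul_smul_comm, smul_add]
  module

theorem hecke_mul_sq (ha : a * a = 1 + z • a) (hab : a * b * a = b * a * b) :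
    (a * b) ^ 2 = b * a + z • (a * b * a) := by
  rw [sq, show a * b * (a * b) = a * (b * a * b) by simp only [mul_assoc], ← hab,
    show a * (a * b * a) = (a * a) * b * a by simp only [mul_assoc], ha]
  simp [add_mul]

end Hecke

/-- Solutions of a palindromic linear recurrence of order four are determined by four values. -/
theorem eq_zero_of_recurrence {c d : ℂ} {f : ℤ → ℂ}
    (hf : ∀ n, f (n + 4) - c * f (n + 3) - d * f (n + 2) - c * f (n + 1) + f n = 0)
    (h0 : f (-1) = 0) (h1 : f 0 = 0) (h2 : f 1 = 0) (h3 : f 2 = 0) (n : ℤ) : f n = 0 := by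
  -- Windows of four consecutive zeros move in both directions, since the coefficients of f (n + 4)
  -- and f n are both 1.
  have key : ∀ n, f (n - 1) = 0 ∧ f n = 0 ∧ f (n + 1) = 0 ∧ f (n + 2) = 0 := by
    intro n
    induction n using Int.induction_on with
    | zero => exact ⟨h0, h1, h2, h3⟩
    | succ n ih =>
      obtain ⟨i0, i1, i2, i3⟩ := ih
      have := hf ((n : ℤ) - 1)
      ring_nf at this i0 i1 i2 i3 ⊢
      simp_all
    | pred n ih =>
      obtain ⟨i0, i1, i2, i3⟩ := ih
      have := hf (-(n : ℤ) - 2)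
      ring_nf at this i0 i1 i2 i3 ⊢
      simp_all
  exact (key n).2.1

/-! ### Weighted traces -/

theorem trace_weightOp_mul (q : ℂˣ) (N m : ℕ) (M : Module.End ℂ (TensorSpace N m)) :
    LinearMap.trace ℂ (TensorSpace N m) (weightOp q N m * M) =
      ∑ x : Fin m → Fin N, (∏ a, ((q ^ ((N : ℤ) - 1 - 2 * ((x a : ℕ) : ℤ)) : ℂˣ) : ℂ)) *
        M (Pi.single x 1) x := by
  rw [LinearMap.trace_eq_matrix_trace ℂ (Pi.basisFun ℂ (Fin m → Fin N)), Matrix.trace]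
  refine Finset.sum_congr rfl fun x _ => ?_
  simp [weightOp]

/-- The weight of a word depends only on its multiset of letters. Together with cyclicity of the
trace, this lets R-matrices be rotated cyclically inside a weighted trace. -/
theorem weightOp_comm_rMap (q : ℂˣ) (N : ℕ) {m : ℕ} (a b : Fin m) :
    weightOp q N m * rMap q N a b = rMap q N a b * weightOp q N m := by
  refine LinearMap.ext fun v => funext fun x => ?_
  have h : (∏ c, ((q ^ ((N : ℤ) - 1 - 2 * (((x ∘ Equiv.swap a b) c : ℕ) : ℤ)) : ℂˣ) : ℂ)) =
      ∏ c, ((q ^ ((N : ℤ) - 1 - 2 * ((x c : ℕ) : ℤ)) : ℂˣ) : ℂ) :=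
    Equiv.prod_comp (Equiv.swap a b)
      (fun c => ((q ^ ((N : ℤ) - 1 - 2 * ((x c : ℕ) : ℤ)) : ℂˣ) : ℂ))
  simp only [Module.End.mul_apply, weightOp, rMap, LinearMap.pi_apply, LinearMap.coe_mk,
    AddHom.coe_mk, LinearMap.smul_apply, LinearMap.proj_apply, smul_eq_mul, h]
  split_ifs <;> ring

/-- The diagonal entries of the `R`-matrix. -/
def rDiag (q : ℂˣ) {N : ℕ} (i j : Fin N) : ℂ :=
  if i = j then (q : ℂ) else if i < j then (q : ℂ) - (q : ℂ)⁻¹ else 0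

/-- The diagonal entries of `q^ρ`. -/
def rhoDiag (q : ℂˣ) {N : ℕ} (i : Fin N) : ℂ := ((q ^ ((N : ℤ) - 1 - 2 * ((i : ℕ) : ℤ)) : ℂˣ) : ℂ)

/-- The first factor is summed innermost, so that partial traces are taken from the left. -/
theorem sum_cons₃ {N : ℕ} (f : (Fin 3 → Fin N) → ℂ) :
    ∑ x, f x = ∑ k : Fin N, ∑ j : Fin N, ∑ i : Fin N, f ![i, j, k] := by
  let e : Fin N × Fin N × Fin N ≃ (Fin 3 → Fin N) :=
    { toFun := fun p => ![p.2.2, p.2.1, p.1]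
      invFun := fun x => (x 2, x 1, x 0)
      left_inv := fun p => rfl
      right_inv := fun x => by funext c; fin_cases c <;> rfl }
  rw [← e.sum_comp, Fintype.sum_prod_type]
  refine Finset.sum_congr rfl fun k _ => ?_
  rw [Fintype.sum_prod_type]
  rfl

/-- A telescoping sum. It is used with n = N for the quantum dimension and with n = j for the
partial trace of R. -/
theorem sum_range_zpow_mul (q : ℂˣ) (n : ℕ) (c : ℤ) :
    (∑ i ∈ Finset.range n, ((q ^ (c - 1 - 2 * (i : ℤ)) : ℂˣ) : ℂ)) * ((q : ℂ) - (q : ℂ)⁻¹) =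
      ((q ^ c : ℂˣ) : ℂ) - ((q ^ (c - 2 * (n : ℤ)) : ℂˣ) : ℂ) := by
  have hq := q.ne_zero
  induction n with
  | zero => simp
  | succ n ih =>
    rw [Finset.sum_range_succ, add_mul, ih]
    simp only [Units.val_zpow_eq_zpow_val]
    rw [show c - 2 * ((n + 1 : ℕ) : ℤ) = (c - 1 - 2 * n) - 1 by push_cast; ring,
      show c - 2 * (n : ℤ) = (c - 1 - 2 * n) + 1 by ring, zpow_sub_one₀ hq, zpow_add_one₀ hq]
    ring

theorem sum_rhoDiag (q : ℂˣ) (N : ℕ) :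
    (∑ i : Fin N, rhoDiag q i) * ((q : ℂ) - (q : ℂ)⁻¹) = (q : ℂ) ^ N - ((q : ℂ) ^ N)⁻¹ := by
  have h := sum_range_zpow_mul q N N
  rw [← Fin.sum_univ_eq_sum_range (fun i => ((q ^ ((N : ℤ) - 1 - 2 * (i : ℤ)) : ℂˣ) : ℂ))] at h
  rw [show (N : ℤ) - 2 * N = -N by ring] at h
  simpa [rhoDiag] using h

/-- The Markov property. The terms i < j telescope to q^N - q^{N-2j}, and the term i = j contributes
q · q^{N-1-2j} = q^{N-2j}, so the sum does not depend on j. -/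
theorem sum_rhoDiag_mul_rDiag (q : ℂˣ) {N : ℕ} (j : Fin N) :
    ∑ i : Fin N, rhoDiag q i * rDiag q i j = (q : ℂ) ^ N := by
  have hq := q.ne_zero
  have h := sum_range_zpow_mul q j N
  have h2 : ∑ i : Fin N, rhoDiag q i * rDiag q i j =
      ∑ i ∈ Finset.range N, ((if i = j then ((q ^ ((N : ℤ) - 1 - 2 * (i : ℤ)) : ℂˣ) : ℂ) * q else 0)
       + if i < j then ((q ^ ((N : ℤ) - 1 - 2 * (i : ℤ)) : ℂˣ) : ℂ) * ((q : ℂ) - (q : ℂ)⁻¹) else 0) := by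
    rw [← Fin.sum_univ_eq_sum_range (fun i : ℕ =>
      ((if i = j then ((q ^ ((N : ℤ) - 1 - 2 * (i : ℤ)) : ℂˣ) : ℂ) * q else 0)
       + if i < j then ((q ^ ((N : ℤ) - 1 - 2 * (i : ℤ)) : ℂˣ) : ℂ) * ((q : ℂ) - (q : ℂ)⁻¹) else 0))]
    refine Finset.sum_congr rfl fun i _ => ?_
    rcases lt_trichotomy i j with hij | hij | hij
    · simp [rhoDiag, rDiag, hij, hij.ne, Fin.val_ne_of_ne hij.ne]
    · simp [rhoDiag, rDiag, hij]
    · simp [rhoDiag, rDiag, hij.ne', hij.not_gt, Fin.val_ne_of_ne hij.ne']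
  rw [h2, Finset.sum_add_distrib, Finset.sum_ite_eq' (Finset.range N) (j : ℕ),
    if_pos (Finset.mem_range.2 j.2), ← Finset.sum_filter]
  have h3 : (Finset.range N).filter (· < (j : ℕ)) = Finset.range j := by
    ext i; simp only [Finset.mem_filter, Finset.mem_range]; omega
  rw [h3, ← Finset.sum_mul, h]
  simp only [Units.val_zpow_eq_zpow_val]
  rw [show (N : ℤ) - 2 * (j : ℕ) = ((N : ℤ) - 1 - 2 * (j : ℕ)) + 1 by ring, zpow_add_one₀ hq]
  simp

theorem rMap_basisVec_apply_self (q : ℂˣ) {N m : ℕ} (a b : Fin m) (x : Fin m → Fin N) :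
    rMap q N a b (Pi.single x 1) x = rDiag q (x a) (x b) := by
  have h : x a ≠ x b → x ∘ Equiv.swap a b ≠ x := fun h h' => h (by
    conv_lhs => rw [← h']
    simp)
  simp only [rMap, LinearMap.coe_mk, AddHom.coe_mk, rDiag]
  split_ifs with h1 h2 <;> simp [h, h1]

/-- A diagonal entry receives no contribution from a true exchange of places a and b: the other
factor leaves place a alone and cannot undo it. So the entry is a product of diagonal entries. -/
theorem rMap_mul_rMap_basisVec_apply_self (q : ℂˣ) {N m : ℕ} {a b c : Fin m} (hab : a ≠ b)
    (hac : a ≠ c) (x : Fin m → Fin N) :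
    (rMap q N a b * rMap q N b c) (Pi.single x 1) x = rDiag q (x a) (x b) * rDiag q (x b) (x c) := by
  have h : x a ≠ x b → rMap q N b c (Pi.single x 1) (x ∘ Equiv.swap a b) = 0 := by
    intro h
    have e1 : x ∘ Equiv.swap a b ≠ x := fun h' => h (by
      conv_lhs => rw [← h']
      simp)
    have e2 : (x ∘ Equiv.swap a b) ∘ Equiv.swap b c ≠ x := fun h' => h (by
      conv_lhs => rw [← h']
      simp [Equiv.swap_apply_of_ne_of_ne hab hac])
    simp only [rMap, LinearMap.coe_mk, AddHom.coe_mk]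
    split_ifs <;> simp [e1, e2]
  rw [Module.End.mul_apply, ← rMap_basisVec_apply_self q b c x]
  generalize rMap q N b c (Pi.single x 1) = w at h
  simp only [rMap, LinearMap.coe_mk, AddHom.coe_mk, rDiag]
  split_ifs with h1 h2 <;> simp [h, h1]

section
variable (q : ℂˣ) (N : ℕ)

theorem trace_weightOp_mul₃ (M : Module.End ℂ (TensorSpace N 3)) :
    LinearMap.trace ℂ (TensorSpace N 3) (weightOp q N 3 * M) =
      ∑ k : Fin N, ∑ j : Fin N, ∑ i : Fin N, rhoDiag q i * rhoDiag q j * rhoDiag q k *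
        M (Pi.single ![i, j, k] 1) ![i, j, k] := by
  rw [trace_weightOp_mul, sum_cons₃]
  simp [Fin.prod_univ_three, rhoDiag]

theorem trace_weightOp :
    LinearMap.trace ℂ (TensorSpace N 3) (weightOp q N 3) = (∑ i : Fin N, rhoDiag q i) ^ 3 := by
  have h := trace_weightOp_mul₃ q N 1
  rw [mul_one] at h
  rw [h]
  simp only [Module.End.one_apply, Pi.single_eq_same, mul_one, ← Finset.sum_mul, ← Finset.mul_sum]
  ring

theorem trace_weightOp_mul_rMap_zero_one :
    LinearMap.trace ℂ (TensorSpace N 3) (weightOp q N 3 * rMap q N 0 1) =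
      (q : ℂ) ^ N * (∑ i : Fin N, rhoDiag q i) ^ 2 := by
  rw [trace_weightOp_mul₃]
  simp only [rMap_basisVec_apply_self]
  calc _ = ∑ k : Fin N, ∑ j : Fin N, rhoDiag q j * rhoDiag q k *
        ∑ i : Fin N, rhoDiag q i * rDiag q i j := by
        simp only [Finset.mul_sum]
        refine Finset.sum_congr rfl fun k _ => Finset.sum_congr rfl fun j _ =>
          Finset.sum_congr rfl fun i _ => ?_
        simp only [Matrix.cons_val_zero, Matrix.cons_val_one]
        ring
    _ = _ := by
        simp only [sum_rhoDiag_mul_rDiag, ← Finset.sum_mul, ← Finset.mul_sum]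
        ring

theorem trace_weightOp_mul_rMap_one_two :
    LinearMap.trace ℂ (TensorSpace N 3) (weightOp q N 3 * rMap q N 1 2) =
      (q : ℂ) ^ N * (∑ i : Fin N, rhoDiag q i) ^ 2 := by
  rw [trace_weightOp_mul₃]
  simp only [rMap_basisVec_apply_self]
  calc _ = ∑ k : Fin N, rhoDiag q k * ((∑ i : Fin N, rhoDiag q i) *
        ∑ j : Fin N, rhoDiag q j * rDiag q j k) := by
        simp only [Finset.mul_sum, Finset.sum_mul]
        refine Finset.sum_congr rfl fun k _ => Finset.sum_congr rfl fun j _ =>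
          Finset.sum_congr rfl fun i _ => ?_
        simp only [Matrix.cons_val_one, Matrix.cons_val]
        ring
    _ = _ := by
        simp only [sum_rhoDiag_mul_rDiag, ← Finset.sum_mul]
        ring

theorem trace_weightOp_mul_rMap_mul_rMap :
    LinearMap.trace ℂ (TensorSpace N 3) (weightOp q N 3 * (rMap q N 0 1 * rMap q N 1 2)) =
      ((q : ℂ) ^ N) ^ 2 * ∑ i : Fin N, rhoDiag q i := by
  rw [trace_weightOp_mul₃]
  simp only [rMap_mul_rMap_basisVec_apply_self q (show (0 : Fin 3) ≠ 1 by decide)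
    (show (0 : Fin 3) ≠ 2 by decide)]
  calc _ = ∑ k : Fin N, rhoDiag q k * ∑ j : Fin N, rhoDiag q j * rDiag q j k *
        ∑ i : Fin N, rhoDiag q i * rDiag q i j := by
        simp only [Finset.mul_sum]
        refine Finset.sum_congr rfl fun k _ => Finset.sum_congr rfl fun j _ =>
          Finset.sum_congr rfl fun i _ => ?_
        simp only [Matrix.cons_val_zero, Matrix.cons_val_one, Matrix.cons_val]
        ring
    _ = _ := by
        simp only [sum_rhoDiag_mul_rDiag, ← Finset.sum_mul]
        ring

end

/-! ### Traces of the powers of the torus braid -/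

/-- Multiply the quartic relation by the n-th power of ab, with n any integer as ab is a unit, and
apply f. -/
theorem hecke_recurrence {A : Type*} [Ring A] [Algebra ℂ A] {a b : Aˣ} {z : ℂ}
    (ha : (a : A) * a = 1 + z • (a : A)) (hb : (b : A) * b = 1 + z • (b : A))
    (hab : (a : A) * b * a = b * a * b) (f : A →ₗ[ℂ] ℂ) (n : ℤ) :
    f ((a * b) ^ (n + 4) : Aˣ) - (1 + z ^ 2) * f ((a * b) ^ (n + 3) : Aˣ) -
      z ^ 2 * f ((a * b) ^ (n + 2) : Aˣ) - (1 + z ^ 2) * f ((a * b) ^ (n + 1) : Aˣ) +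
      f ((a * b) ^ n : Aˣ) = 0 := by
  have h := hecke_mul_pow_relation ha hb hab
  rw [← Units.val_mul] at h
  generalize a * b = T at h
  have h2 := congrArg (fun x => f (((T ^ n : Aˣ) : A) * x)) h
  simp only [mul_zero, map_zero, mul_add, mul_sub, mul_smul_comm, mul_one, map_add, map_sub,
    map_smul, smul_eq_mul] at h2
  have e : ∀ k : ℕ, ((T ^ (n + k) : Aˣ) : A) = (T ^ n : Aˣ) * (T : A) ^ k := fun k => by
    rw [zpow_add, zpow_natCast, Units.val_mul, Units.val_pow_eq_pow_val]
  have e1 := e 1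
  rw [pow_one] at e1
  rw [← h2, ← e1, ← e 2, ← e 3, ← e 4]
  rfl

section
variable (q : ℂˣ) (N : ℕ)

theorem weightedTrace_torusBraid (n : ℤ) :
    weightedTrace q N (torusBraid n) =
      LinearMap.trace ℂ (TensorSpace N 3) (weightOp q N 3 *
        (((rUnit q N 0 1 * rUnit q N 1 2) ^ n : (Module.End ℂ (TensorSpace N 3))ˣ) :
          Module.End ℂ (TensorSpace N 3))) := by
  have h : braidRep q N 2 (sigma 0 * sigma 1) = rUnit q N 0 1 * rUnit q N 1 2 := by
    rw [map_mul]
    simp only [braidRep, sigma, PresentedGroup.toGroup.of]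
    rfl
  rw [weightedTrace, torusBraid, map_zpow, h]

theorem rMap_adjacent₃ :
    rMap q N (0 : Fin 3) 1 * rMap q N 1 2 * rMap q N 0 1 =
      rMap q N 1 2 * rMap q N 0 1 * rMap q N 1 2 :=
  rMap_braid q N (by decide) (by decide) (by decide)

theorem weightedTrace_torusBraid_recurrence (n : ℤ) :
    weightedTrace q N (torusBraid (n + 4)) -
      (1 + ((q : ℂ) - (q : ℂ)⁻¹) ^ 2) * weightedTrace q N (torusBraid (n + 3)) -
      ((q : ℂ) - (q : ℂ)⁻¹) ^ 2 * weightedTrace q N (torusBraid (n + 2)) -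
      (1 + ((q : ℂ) - (q : ℂ)⁻¹) ^ 2) * weightedTrace q N (torusBraid (n + 1)) +
      weightedTrace q N (torusBraid n) = 0 := by
  simp only [weightedTrace_torusBraid]
  exact hecke_recurrence (a := rUnit q N (0 : Fin 3) 1) (b := rUnit q N 1 2)
    (rMap_mul_self q N 0 1) (rMap_mul_self q N 1 2) (rMap_adjacent₃ q N)
    (LinearMap.trace ℂ (TensorSpace N 3) ∘ₗ LinearMap.mulLeft ℂ (weightOp q N 3)) n

theorem rUnit_inv_val {m : ℕ} (a b : Fin m) :
    (((rUnit q N a b)⁻¹ : (Module.End ℂ (TensorSpace N m))ˣ) : Module.End ℂ (TensorSpace N m)) =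
      rMap q N a b - ((q : ℂ) - (q : ℂ)⁻¹) • 1 :=
  rMapInv_eq q N a b

theorem weightedTrace_torusBraid_zero :
    weightedTrace q N (torusBraid 0) = (∑ i : Fin N, rhoDiag q i) ^ 3 := by
  rw [weightedTrace_torusBraid, zpow_zero, Units.val_one, mul_one, trace_weightOp]

theorem weightedTrace_torusBraid_one :
    weightedTrace q N (torusBraid 1) = ((q : ℂ) ^ N) ^ 2 * ∑ i : Fin N, rhoDiag q i := by
  rw [weightedTrace_torusBraid, zpow_one, ← trace_weightOp_mul_rMap_mul_rMap]
  rfl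

/-- Expand the product of the inverses R - z; the trace of R₂R₁ equals that of R₁R₂ by cyclicity. By
`sum_rhoDiag` the squared bracket is q^{-2N}. -/
theorem weightedTrace_torusBraid_neg_one :
    weightedTrace q N (torusBraid (-1)) = (∑ i : Fin N, rhoDiag q i) *
      ((q : ℂ) ^ N - ((q : ℂ) - (q : ℂ)⁻¹) * ∑ i : Fin N, rhoDiag q i) ^ 2 := by
  have h : LinearMap.trace ℂ (TensorSpace N 3)
      (weightOp q N 3 * (rMap q N 1 2 * rMap q N 0 1)) =
      ((q : ℂ) ^ N) ^ 2 * ∑ i : Fin N, rhoDiag q i := by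
    rw [← trace_weightOp_mul_rMap_mul_rMap, ← mul_assoc, weightOp_comm_rMap, mul_assoc,
      LinearMap.trace_mul_comm, mul_assoc]
  rw [weightedTrace_torusBraid, zpow_neg_one, mul_inv_rev, Units.val_mul, rUnit_inv_val,
    rUnit_inv_val]
  simp only [mul_sub, sub_mul, mul_smul_comm, smul_mul_assoc, mul_one, one_mul, map_sub, map_smul,
    h, trace_weightOp, trace_weightOp_mul_rMap_zero_one, trace_weightOp_mul_rMap_one_two,
    smul_eq_mul]
  ring

/-- Here (ab)² = ba + z·aba, and under the weighted trace ba becomes ab and aba becomes a·ab = b +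
z·ab. -/
theorem weightedTrace_torusBraid_two :
    weightedTrace q N (torusBraid 2) =
      ((q : ℂ) - (q : ℂ)⁻¹) * ((q : ℂ) ^ N * (∑ i : Fin N, rhoDiag q i) ^ 2) +
      (1 + ((q : ℂ) - (q : ℂ)⁻¹) ^ 2) * (((q : ℂ) ^ N) ^ 2 * ∑ i : Fin N, rhoDiag q i) := by
  set z := (q : ℂ) - (q : ℂ)⁻¹ with hz
  set a := rMap q N (0 : Fin 3) 1 with ha
  set b := rMap q N (1 : Fin 3) 2 with hb
  have haa : a * a = 1 + z • a := rMap_mul_self q N 0 1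
  have hab : a * b * a = b * a * b := rMap_adjacent₃ q N
  have h1 : (((rUnit q N 0 1 * rUnit q N 1 2) ^ (2 : ℤ) : (Module.End ℂ (TensorSpace N 3))ˣ) :
      Module.End ℂ (TensorSpace N 3)) = (a * b) ^ 2 := rfl
  have hw : ∀ x, LinearMap.trace ℂ (TensorSpace N 3) (weightOp q N 3 * (x * a)) =
      LinearMap.trace ℂ (TensorSpace N 3) (weightOp q N 3 * (a * x)) := fun x => by
    rw [← mul_assoc, LinearMap.trace_mul_comm, ← mul_assoc, ← mul_assoc, weightOp_comm_rMap]
  have h2 : a * (a * b) = b + z • (a * b) := by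
    rw [← mul_assoc, haa, add_mul, one_mul, smul_mul_assoc]
  rw [weightedTrace_torusBraid, h1, hecke_mul_sq haa hab, mul_add, map_add, mul_smul_comm,
    map_smul, hw, hw, h2, mul_add, map_add, mul_smul_comm, map_smul,
    trace_weightOp_mul_rMap_mul_rMap, trace_weightOp_mul_rMap_one_two]
  simp only [smul_eq_mul]
  ring

end

/-! ### The values of the Schur functions -/

section
variable {R : Type*} [CommRing R] [Algebra ℂ R] (p : ℕ → R)

theorem completeHom_one : completeHom p 1 = p 1 := by
  simp [completeHom]

theorem completeHom_two : completeHom p 2 = (2 : ℂ)⁻¹ • (p 1 ^ 2 + p 2) := by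
  rw [completeHom, Fin.sum_univ_two]
  simp [completeHom]
  norm_num [sq]

theorem completeHom_three :
    completeHom p 3 = (6 : ℂ)⁻¹ • (p 1 ^ 3 + (3 : ℂ) • (p 1 * p 2) + (2 : ℂ) • p 3) := by
  rw [completeHom, Fin.sum_univ_three]
  simp only [Fin.val_zero, Fin.val_one, Fin.val_two, Nat.sub_zero, Nat.sub_self, zero_add,
    Nat.reduceAdd, Nat.reduceSub, completeHom_one, completeHom_two, completeHom, mul_one,
    mul_smul_comm]
  push_cast
  rw [show p 1 * (p 1 ^ 2 + p 2) = p 1 ^ 3 + p 1 * p 2 by ring, mul_comm (p 2)]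
  module

theorem schur_three : schur p [3] = completeHom p 3 := by
  simp [schur, Matrix.det_unique]

theorem schur_two_one : schur p [2, 1] = completeHom p 2 * completeHom p 1 - completeHom p 3 := by
  change Matrix.det (n := Fin 2) _ = _
  rw [Matrix.det_fin_two]
  simp [completeHom.eq_1]

theorem schur_one_one_one : schur p [1, 1, 1] =
    completeHom p 1 ^ 3 - 2 * (completeHom p 1 * completeHom p 2) + completeHom p 3 := by
  change Matrix.det (n := Fin 3) _ = _
  rw [Matrix.det_fin_three]
  simp [completeHom.eq_1]
  ring

end

/-! ### Evaluation of Laurent polynomials -/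

theorem eval₂_eq_zero_unique {q : ℂˣ} (hq : ∀ k : ℕ, 0 < k → q ^ k ≠ 1) {H : LaurentPolynomial ℂ}
    (h : ∀ N : ℕ, 1 ≤ N → LaurentPolynomial.eval₂ (RingHom.id ℂ) (q ^ N) H = 0) : H = 0 := by
  obtain ⟨n, p, hp⟩ := LaurentPolynomial.exists_T_pow H
  -- This is where q not being a root of unity gives infinitely many evaluation points.
  have hinj : Function.Injective fun N : ℕ => ((q ^ (N + 1) : ℂˣ) : ℂ) := by
    have key : ∀ a b : ℕ, a < b → q ^ (a + 1) ≠ q ^ (b + 1) := by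
      intro a b hab h
      refine hq (b - a) (by omega) ?_
      rw [show b + 1 = (a + 1) + (b - a) by omega, pow_add q (a + 1)] at h
      exact (mul_eq_left.1 h.symm)
    intro a b hab
    have hab' := Units.ext hab
    rcases lt_trichotomy a b with h1 | h1 | h1
    · exact absurd hab' (key a b h1)
    · exact h1
    · exact absurd hab'.symm (key b a h1)
  have hp0 : p = 0 := by
    refine Polynomial.eq_zero_of_infinite_isRoot p ((Set.infinite_range_of_injective hinj).mono ?_)
    rintro _ ⟨N, rfl⟩
    have h1 := congrArg (LaurentPolynomial.eval₂ (RingHom.id ℂ) (q ^ (N + 1))) hp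
    rw [map_mul, h (N + 1) (by omega), zero_mul, LaurentPolynomial.eval₂_toLaurent] at h1
    simpa [Polynomial.IsRoot, Polynomial.eval₂_id] using h1
  rw [hp0, map_zero] at hp
  exact ((LaurentPolynomial.isUnit_T n).mul_left_eq_zero).1 hp.symm

/-- Evaluation of Laurent polynomials as an algebra homomorphism. -/
def evalHom (u : ℂˣ) : LaurentPolynomial ℂ →ₐ[ℂ] ℂ :=
  { LaurentPolynomial.eval₂ (RingHom.id ℂ) u with
    commutes' := fun c => by
      change LaurentPolynomial.eval₂ (RingHom.id ℂ) u (LaurentPolynomial.C c) = _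
      simp }

theorem evalHom_powerSumStar (q u : ℂˣ) (k : ℕ) :
    evalHom u (powerSumStar q k) =
      ((u : ℂ) ^ k - ((u : ℂ) ^ k)⁻¹) / ((q : ℂ) ^ k - ((q : ℂ) ^ k)⁻¹) := by
  change LaurentPolynomial.eval₂ (RingHom.id ℂ) u _ = _
  rw [powerSumStar, map_mul, map_sub]
  simp
  ring

section
variable {R S : Type*} [CommRing R] [Algebra ℂ R] [CommRing S] [Algebra ℂ S] (p : ℕ → R)
  (f : R →ₐ[ℂ] S)

theorem map_completeHom (n : ℕ) : f (completeHom p n) = completeHom (f ∘ p) n := by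
  induction n using Nat.strong_induction_on with
  | _ n ih =>
    cases n with
    | zero => simp [completeHom]
    | succ n =>
      rw [completeHom, completeHom, map_smul, map_sum]
      congr 1
      refine Finset.sum_congr rfl fun i _ => ?_
      rw [map_mul, ih _ (by omega), Function.comp_apply]

theorem map_schur (Q : List ℕ) : f (schur p Q) = schur (f ∘ p) Q := by
  rw [schur, schur, AlgHom.map_det]
  congr 1
  ext i j
  simp only [AlgHom.mapMatrix_apply, Matrix.map_apply, Matrix.of_apply]
  split_ifs
  · exact map_completeHom p f _
  · exact map_zero f

end

/-! ### The three-strand formula -/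

/-- The trace of the `n`-th power of a rotation by `2π / 3`. -/
def rotationTrace (n : ℤ) : ℂ := ((2 * Real.cos (2 * Real.pi * n / 3) : ℝ) : ℂ)

/-- The primitive cube roots of unity are the roots of X² + X + 1. -/
theorem rotationTrace_add_two (n : ℤ) :
    rotationTrace (n + 2) + rotationTrace (n + 1) + rotationTrace n = 0 := by
  have h : Real.cos (2 * Real.pi / 3) = -1 / 2 := by
    rw [show 2 * Real.pi / 3 = Real.pi - Real.pi / 3 by ring, Real.cos_pi_sub, Real.cos_pi_div_three]
    norm_num
  rw [rotationTrace, rotationTrace, rotationTrace]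
  have e1 : 2 * Real.pi * ((n + 2 : ℤ) : ℝ) / 3 =
      2 * Real.pi * ((n + 1 : ℤ) : ℝ) / 3 + 2 * Real.pi / 3 := by push_cast; ring
  have e2 : 2 * Real.pi * (n : ℝ) / 3 =
      2 * Real.pi * ((n + 1 : ℤ) : ℝ) / 3 - 2 * Real.pi / 3 := by push_cast; ring
  rw [e1, e2, Real.cos_add, Real.cos_sub, h]
  push_cast
  ring

theorem rotationTrace_zero : rotationTrace 0 = 2 := by
  simp [rotationTrace]

theorem rotationTrace_one : rotationTrace 1 = -1 := by
  rw [rotationTrace, show 2 * Real.pi * ((1 : ℤ) : ℝ) / 3 = Real.pi - Real.pi / 3 by push_cast; ring,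
    Real.cos_pi_sub, Real.cos_pi_div_three]
  norm_num

theorem rotationTrace_two : rotationTrace 2 = -1 := by
  have := rotationTrace_add_two 0
  rw [zero_add, zero_add, rotationTrace_zero, rotationTrace_one] at this
  linear_combination this

theorem rotationTrace_neg_one : rotationTrace (-1) = -1 := by
  have := rotationTrace_add_two (-1)
  norm_num at this
  rw [rotationTrace_zero, rotationTrace_one] at this
  linear_combination this

/-- The powers of q^{±2} are killed by the factor X² - (z² + 2)X + 1 of the characteristic
polynomial, `rotationTrace` by the factor X² + X + 1. -/
theorem character_recurrence (q : ℂˣ) (x y w : ℂ) {f : ℤ → ℂ}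
    (hf : ∀ n, f n = ((q ^ (2 * n) : ℂˣ) : ℂ) * x + rotationTrace n * y +
      ((q ^ (-(2 * n)) : ℂˣ) : ℂ) * w) (n : ℤ) :
    f (n + 4) - (1 + ((q : ℂ) - (q : ℂ)⁻¹) ^ 2) * f (n + 3) -
      ((q : ℂ) - (q : ℂ)⁻¹) ^ 2 * f (n + 2) - (1 + ((q : ℂ) - (q : ℂ)⁻¹) ^ 2) * f (n + 1) +
      f n = 0 := by
  have hq := q.ne_zero
  have h0 := rotationTrace_add_two n
  have h1 := rotationTrace_add_two (n + 1)
  have h2 := rotationTrace_add_two (n + 2)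
  simp only [add_assoc, Int.reduceAdd] at h0 h1 h2
  have e : ∀ k : ℕ, ((q ^ (2 * (n + k)) : ℂˣ) : ℂ) = ((q ^ (2 * n) : ℂˣ) : ℂ) * (q : ℂ) ^ (2 * k) :=
    fun k => by
      rw [mul_add, zpow_add, Units.val_mul]
      congr 1
  have e' : ∀ k : ℕ, ((q ^ (-(2 * (n + k))) : ℂˣ) : ℂ) =
      ((q ^ (-(2 * n)) : ℂˣ) : ℂ) * ((q : ℂ)⁻¹) ^ (2 * k) := fun k => by
    rw [mul_add, neg_add, zpow_add, Units.val_mul]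
    congr 1
    rw [zpow_neg, ← inv_zpow]
    simp only [Units.val_zpow_eq_zpow_val, Units.val_inv_eq_inv_val]
    exact_mod_cast rfl
  simp only [hf]
  have e1 := e 1
  have e2 := e 2
  have e3 := e 3
  have e4 := e 4
  have f1 := e' 1
  have f2 := e' 2
  have f3 := e' 3
  have f4 := e' 4
  simp only [Nat.cast_one, Nat.cast_ofNat, Nat.reduceMul, inv_pow] at e1 e2 e3 e4 f1 f2 f3 f4
  rw [e1, e2, e3, e4, f1, f2, f3, f4]
  generalize ((q ^ (2 * n) : ℂˣ) : ℂ) = X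
  generalize ((q ^ (-(2 * n)) : ℂˣ) : ℂ) = Y
  generalize rotationTrace (n + 4) = r4 at *
  have g4 : r4 = -(rotationTrace (n + 3)) - rotationTrace (n + 2) := by linear_combination h2
  have g3 : rotationTrace (n + 3) = -(rotationTrace (n + 2)) - rotationTrace (n + 1) := by
    linear_combination h1
  have g2 : rotationTrace (n + 2) = -(rotationTrace (n + 1)) - rotationTrace n := by
    linear_combination h0
  rw [g4, g3, g2]
  field_simp
  ring

/-- The comparison at n = 0, 1, -1, 2, in this order, with a standing for q^N. -/
theorem torusBraid_character_identities {q a : ℂ} (hq : q ≠ 0) (ha : a ≠ 0) (h1 : q ^ 2 - 1 ≠ 0)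
    (h2 : (q ^ 2) ^ 2 - 1 ≠ 0) (h3 : (q ^ 3) ^ 2 - 1 ≠ 0) {p : ℕ → ℂ}
    (hp : ∀ k, p k = (a ^ k - (a ^ k)⁻¹) / (q ^ k - (q ^ k)⁻¹)) :
    schur p [3] + 2 * schur p [2, 1] + schur p [1, 1, 1] = p 1 ^ 3 ∧
    q ^ 2 * schur p [3] - schur p [2, 1] + (q ^ 2)⁻¹ * schur p [1, 1, 1] = a ^ 2 * p 1 ∧
    (q ^ 2)⁻¹ * schur p [3] - schur p [2, 1] + q ^ 2 * schur p [1, 1, 1] =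
      p 1 * (a - (q - q⁻¹) * p 1) ^ 2 ∧
    q ^ 4 * schur p [3] - schur p [2, 1] + (q ^ 4)⁻¹ * schur p [1, 1, 1] =
      (q - q⁻¹) * (a * p 1 ^ 2) + (1 + (q - q⁻¹) ^ 2) * (a ^ 2 * p 1) := by
  have e : ∀ x : ℂ, x ≠ 0 → x - x⁻¹ = (x ^ 2 - 1) / x := fun x hx => by field_simp
  have p1 : p 1 = (a ^ 2 - 1) * q / (a * (q ^ 2 - 1)) := by
    rw [hp, pow_one, pow_one, e q hq, e a ha]; field_simp
  have p2 : p 2 = (a ^ 4 - 1) * q ^ 2 / (a ^ 2 * ((q ^ 2) ^ 2 - 1)) := by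
    rw [hp, e _ (pow_ne_zero 2 hq), e _ (pow_ne_zero 2 ha)]; field_simp
  have p3 : p 3 = (a ^ 6 - 1) * q ^ 3 / (a ^ 3 * ((q ^ 3) ^ 2 - 1)) := by
    rw [hp, e _ (pow_ne_zero 3 hq), e _ (pow_ne_zero 3 ha)]; field_simp
  have hp' : q ^ 2 + 1 ≠ 0 := fun h => h2 (by linear_combination (q ^ 2 - 1) * h)
  have hp'' : q ^ 4 + q ^ 2 + 1 ≠ 0 := fun h => h3 (by linear_combination (q ^ 2 - 1) * h)
  rw [show (q ^ 2) ^ 2 - 1 = (q ^ 2 - 1) * (q ^ 2 + 1) by ring] at p2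
  rw [show (q ^ 3) ^ 2 - 1 = (q ^ 2 - 1) * (q ^ 4 + q ^ 2 + 1) by ring] at p3
  -- The factor d of q⁶ - 1 stays atomic while denominators are cleared, and is expanded only
  -- afterwards.
  obtain ⟨d, hd⟩ : ∃ d, d = q ^ 4 + q ^ 2 + 1 := ⟨_, rfl⟩
  rw [← hd] at p3 hp''
  rw [schur_three, schur_two_one, schur_one_one_one, completeHom_one, completeHom_two,
    completeHom_three]
  simp only [smul_eq_mul]
  -- The case n = 0 holds for arbitrary power sums; the other three need the special values.
  refine ⟨by ring, ?_, ?_, ?_⟩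
  · rw [p1, p2, p3]; field_simp; rw [hd]; ring
  · rw [p1, p2, p3]; field_simp; rw [hd]; ring
  · rw [p1, p2, p3]; field_simp; rw [hd]; ring

theorem weightedTrace_torusBraid_eq {q : ℂˣ} (hq : ∀ k : ℕ, 0 < k → q ^ k ≠ 1) (N : ℕ)
    (n : ℤ) {p : ℕ → ℂ}
    (hp : ∀ k, p k = (((q : ℂ) ^ N) ^ k - (((q : ℂ) ^ N) ^ k)⁻¹) / ((q : ℂ) ^ k - ((q : ℂ) ^ k)⁻¹)) :
    weightedTrace q N (torusBraid n) = ((q ^ (2 * n) : ℂˣ) : ℂ) * schur p [3] +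
      rotationTrace n * schur p [2, 1] + ((q ^ (-(2 * n)) : ℂˣ) : ℂ) * schur p [1, 1, 1] := by
  have hq0 := q.ne_zero
  have hk : ∀ k : ℕ, 0 < k → ((q : ℂ) ^ k) ^ 2 - 1 ≠ 0 := fun k hk h =>
    hq (k * 2) (by omega) (Units.ext (by
      push_cast
      rw [pow_mul]
      linear_combination h))
  have h1 : (q : ℂ) ^ 2 - 1 ≠ 0 := by simpa using hk 1 one_pos
  obtain ⟨i0, i1, i2, i3⟩ := torusBraid_character_identities hq0 (pow_ne_zero N hq0) h1
    (hk 2 two_pos) (hk 3 three_pos) hp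
  have hs : ∑ i : Fin N, rhoDiag q i = p 1 := by
    have hz : (q : ℂ) - (q : ℂ)⁻¹ ≠ 0 := fun h => h1 (by
      field_simp at h
      simpa using h)
    rw [hp, pow_one, pow_one, eq_div_iff hz, sum_rhoDiag]
  let g : ℤ → ℂ := fun n => ((q ^ (2 * n) : ℂˣ) : ℂ) * schur p [3] +
      rotationTrace n * schur p [2, 1] + ((q ^ (-(2 * n)) : ℂˣ) : ℂ) * schur p [1, 1, 1]
  have hg := character_recurrence q _ _ _ (f := g) fun _ => rfl
  -- The difference of the two sides satisfies the recurrence; it remains to see that it vanishes at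
  -- -1, 0, 1, 2.
  refine sub_eq_zero.1 (eq_zero_of_recurrence (c := 1 + ((q : ℂ) - (q : ℂ)⁻¹) ^ 2)
    (d := ((q : ℂ) - (q : ℂ)⁻¹) ^ 2) (f := fun n => weightedTrace q N (torusBraid n) - g n)
    (fun n => ?_) ?_ ?_ ?_ ?_ n)
  · linear_combination weightedTrace_torusBraid_recurrence q N n - hg n
  · simp only [g, weightedTrace_torusBraid_neg_one, rotationTrace_neg_one, hs, ← i2]
    simp
    norm_cast
    ring
  · simp only [g, weightedTrace_torusBraid_zero, rotationTrace_zero, hs, ← i0]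
    simp
  · simp only [g, weightedTrace_torusBraid_one, rotationTrace_one, hs, ← i1]
    simp
    norm_cast
    ring
  · simp only [g, weightedTrace_torusBraid_two, rotationTrace_two, hs, ← i3]
    simp
    norm_cast
    ring

theorem X_sub_C_mul_X_sub_C_exp :
    (Polynomial.X - Polynomial.C (Complex.exp (2 * Real.pi * Complex.I / 3))) *
      (Polynomial.X - Polynomial.C (Complex.exp (-(2 * Real.pi * Complex.I / 3)))) =
    Polynomial.X ^ 2 + Polynomial.X + 1 := by
  set e := Complex.exp (2 * Real.pi * Complex.I / 3) with he
  set e' := Complex.exp (-(2 * Real.pi * Complex.I / 3)) with he'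
  have h1 : e * e' = 1 := by rw [he, he', ← Complex.exp_add]; simp
  have h2 : e + e' = -1 := by
    have h := rotationTrace_one
    rw [rotationTrace] at h
    push_cast at h
    rw [Complex.two_cos] at h
    rw [← h, he, he']
    congr 2 <;> ring
  have h3 : (Polynomial.C e : Polynomial ℂ) * Polynomial.C e' = 1 := by
    rw [← map_mul, h1, map_one]
  have h4 : (Polynomial.C e : Polynomial ℂ) + Polynomial.C e' = -1 := by
    rw [← map_add, h2, map_neg, map_one]
  linear_combination h3 - Polynomial.X * h4

end BraidHomfly

end

/-! ### Assembly: the formula, its uniqueness and the three spectra -/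

theorem mainTheorem3 (q : ℂˣ) (hq : ∀ k : ℕ, 0 < k → q ^ k ≠ 1) :
    (∀ (n : ℤ) (H : LaurentPolynomial ℂ),
      BraidHomfly.IsHomfly q (BraidHomfly.torusBraid n) H ↔
        H =
          LaurentPolynomial.C ((q ^ (2 * n) : ℂˣ) : ℂ) * BraidHomfly.schurStar q [3] +
          LaurentPolynomial.C ((2 * Real.cos (2 * Real.pi * n / 3) : ℝ) : ℂ) *
            BraidHomfly.schurStar q [2, 1] +
          LaurentPolynomial.C ((q ^ (-(2 * n)) : ℂˣ) : ℂ) * BraidHomfly.schurStar q [1, 1, 1]) ∧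
    (∀ N : ℕ, 1 ≤ N →
      BraidHomfly.HasCharpolyOn q N (BraidHomfly.sigma 0 * BraidHomfly.sigma 1 :
          BraidHomfly.BraidGroup 2) [3]
        (Polynomial.X - Polynomial.C ((q : ℂ) ^ 2))) ∧
    (∀ N : ℕ, 2 ≤ N →
      BraidHomfly.HasCharpolyOn q N (BraidHomfly.sigma 0 * BraidHomfly.sigma 1 :
          BraidHomfly.BraidGroup 2) [2, 1]
        ((Polynomial.X - Polynomial.C (Complex.exp (2 * Real.pi * Complex.I / 3))) *
          (Polynomial.X - Polynomial.C (Complex.exp (-(2 * Real.pi * Complex.I / 3)))))) ∧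
    (∀ N : ℕ, 3 ≤ N →
      BraidHomfly.HasCharpolyOn q N (BraidHomfly.sigma 0 * BraidHomfly.sigma 1 :
          BraidHomfly.BraidGroup 2) [1, 1, 1]
        (Polynomial.X - Polynomial.C (((q : ℂ) ^ 2)⁻¹))) := by
  refine ⟨fun n H => ?_, fun N hN => ?_, fun N hN => ?_, fun N hN => ?_⟩
  · have key : ∀ N : ℕ, LaurentPolynomial.eval₂ (RingHom.id ℂ) (q ^ N)
        (LaurentPolynomial.C ((q ^ (2 * n) : ℂˣ) : ℂ) * BraidHomfly.schurStar q [3] +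
          LaurentPolynomial.C ((2 * Real.cos (2 * Real.pi * n / 3) : ℝ) : ℂ) *
            BraidHomfly.schurStar q [2, 1] +
          LaurentPolynomial.C ((q ^ (-(2 * n)) : ℂˣ) : ℂ) * BraidHomfly.schurStar q [1, 1, 1]) =
        BraidHomfly.weightedTrace q N (BraidHomfly.torusBraid n) := by
      intro N
      -- Evaluation is a ℂ-algebra homomorphism, so it passes through the Schur determinant to the
      -- power sums.
      have hS : ∀ Q, LaurentPolynomial.eval₂ (RingHom.id ℂ) (q ^ N) (BraidHomfly.schurStar q Q) =
          BraidHomfly.schur (BraidHomfly.evalHom (q ^ N) ∘ BraidHomfly.powerSumStar q) Q :=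
        fun Q => BraidHomfly.map_schur _ (BraidHomfly.evalHom (q ^ N)) Q
      rw [BraidHomfly.weightedTrace_torusBraid_eq hq N n fun k =>
        (BraidHomfly.evalHom_powerSumStar q (q ^ N) k).trans (by rw [Units.val_pow_eq_pow_val])]
      simp only [map_add, map_mul, LaurentPolynomial.eval₂_C, RingHom.id_apply]
      rw [hS, hS, hS]
      rfl
    constructor
    · intro h
      refine sub_eq_zero.1 (BraidHomfly.eval₂_eq_zero_unique hq fun N hN => ?_)
      rw [map_sub, h N hN, key, sub_self]
    · rintro rfl N -
      exact key N
  · obtain ⟨N, rfl⟩ := Nat.exists_eq_add_of_le' hN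
    exact BraidHomfly.hasCharpolyOn_one_row q N
  · obtain ⟨N, rfl⟩ := Nat.exists_eq_add_of_le' hN
    rw [BraidHomfly.X_sub_C_mul_X_sub_C_exp]
    exact BraidHomfly.hasCharpolyOn_hook q N
  · obtain ⟨N, rfl⟩ := Nat.exists_eq_add_of_le' hN
    exact BraidHomfly.hasCharpolyOn_column q N
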